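/- Let $M$ be a matrix with entries in $\{0,1,-1\}$ having $t$ columns and $u$ rows; write $M_{i,j}$ for the entry in the $i$-th column from the left and the $j$-th row from the bottom. An $M$-gridding of a permutation $\sigma$ of $\{1,\dots,k\}$ is a pair of sequences $\tfrac12=c_0\le c_1\le\dots\le c_t=k+\tfrac12$ and $\tfrac12=r_0\le r_1\le\dots\le r_u=k+\tfrac12$, with all $c_i-\tfrac12$ and $r_j-\tfrac12$ in $\{0,\dots,k\}$, such that for all $1\le i\le t$, $1\le j\le u$ the subsequence of $\sigma$ with indices between $c_{i-1}$ and $c_i$ and values between $r_{j-1}$ and $r_j$ is increasing if $M_{i,j}=1$, decreasing if $M_{i,j}=-1$, and empty if $M_{i,j}=0$. The monotone grid class $\mathrm{Grid}(M)$ is the set of all permutations that have an $M$-gridding, and $\mathrm{Grid}_k(M)$ is the set of its permutations of length $k$. Its size is the number of non-zero entries of $M$. Its row-column graph $G(M)$ is the bipartite graph whose vertices are the rows and the columns of $M$, with an edge between a row and a column exactly when the corresponding entry of $M$ is non-zero; the class is called connected, or acyclic, if $G(M)$ is. Its growth rate is $\lim_{k\to\infty}|\mathrm{Grid}_k(M)|^{1/k}$,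 if this limit exists. The class is skinny if $M$ has a single row. Let $m$ be a non-negative integer. 1. Every connected acyclic monotone grid class $\mathrm{Grid}(M)$ of size $m$ has a growth rate, and this growth rate is at most $m$, with equality if and only if $G(M)$ is the star $K_{1,m}$. 2. Every skinny grid class given by a $1\times m$ matrix (one row, $m$ columns) with all entries non-zero is connected and acyclic of size $m$, its row-column graph is the star $K_{1,m}$, and its growth rate exists and equals $m$. Thus, among all connected acyclic monotone grid classes of size $m$, the skinny ones have the largest growth rate, and it equals $m$. -/

import Mathlib

open Filter Topology

namespace MonotoneGrid

/-- `IsGridding M σ c r` says that the column dividers `c` and the row dividers `r` form an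
`M`-gridding of the permutation `σ` of length `k`. Matrices have the column (from the left) as first
index and the row (from the bottom) as second index. Positions and values are `0, …, k - 1`; a divider
with value `d` separates the numbers `< d` from the numbers `≥ d` (in one-based numbering it is the
divider `d + 1/2`). -/
structure IsGridding {t u k : ℕ} (M : Matrix (Fin t) (Fin u) SignType) (σ : Equiv.Perm (Fin k))
    (c : Fin (t + 1) → ℕ) (r : Fin (u + 1) → ℕ) : Prop where
  col_mono : Monotone c
  col_zero : c 0 = 0
  col_last : c (Fin.last t) = k
  row_mono : Monotone r
  row_zero : r 0 = 0
  row_last : r (Fin.last u) = k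
  increasing : ∀ i j, M i j = 1 → StrictMonoOn σ
    {p : Fin k | (c i.castSucc ≤ (p : ℕ) ∧ (p : ℕ) < c i.succ) ∧
      r j.castSucc ≤ (σ p : ℕ) ∧ (σ p : ℕ) < r j.succ}
  decreasing : ∀ i j, M i j = -1 → StrictAntiOn σ
    {p : Fin k | (c i.castSucc ≤ (p : ℕ) ∧ (p : ℕ) < c i.succ) ∧
      r j.castSucc ≤ (σ p : ℕ) ∧ (σ p : ℕ) < r j.succ}
  empty : ∀ i j, M i j = 0 →
    {p : Fin k | (c i.castSucc ≤ (p : ℕ) ∧ (p : ℕ) < c i.succ) ∧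
      r j.castSucc ≤ (σ p : ℕ) ∧ (σ p : ℕ) < r j.succ} = ∅

/-- The monotone grid class of `M`: `gridClass M k` is the set of its permutations of length `k`. -/
def gridClass {t u : ℕ} (M : Matrix (Fin t) (Fin u) SignType) (k : ℕ) : Set (Equiv.Perm (Fin k)) :=
  {σ | ∃ c r, IsGridding M σ c r}

/-- The size of a grid class: the number of non-zero entries of its matrix. -/
def gridSize {t u : ℕ} (M : Matrix (Fin t) (Fin u) SignType) : ℕ :=
  (Finset.univ.filter fun p : Fin t × Fin u => M p.1 p.2 ≠ 0).card

/-- The row-column graph: a vertex `Sum.inl i` for each column, a vertex `Sum.inr j` for each row,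
and an edge between them exactly when the corresponding entry is non-zero. -/
def rowColumnGraph {t u : ℕ} (M : Matrix (Fin t) (Fin u) SignType) :
    SimpleGraph (Fin t ⊕ Fin u) :=
  SimpleGraph.fromRel fun x y => ∃ i j, x = Sum.inl i ∧ y = Sum.inr j ∧ M i j ≠ 0

/-- The family `C` (with `C k` its permutations of length `k`) has growth rate `g`: the sequence
`|C k| ^ (1 / k)` converges to `g`. -/
def HasGrowthRate (C : (k : ℕ) → Set (Equiv.Perm (Fin k))) (g : ℝ) : Prop :=
  Tendsto (fun k : ℕ => ((C k).ncard : ℝ) ^ (1 / (k : ℝ))) atTop (𝓝 g)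

/-- The graph `G` is a star with `m` edges. -/
def IsStar {V : Type*} (G : SimpleGraph V) (m : ℕ) : Prop :=
  Nonempty (G ≃g completeBipartiteGraph (Fin 1) (Fin m))

end MonotoneGrid

/-! A gridded permutation is encoded by two words over the non-zero cells: the cells of its points
read by position and read by value. The two words have the same letters, the first has increasing
columns and the second increasing rows. Conversely, such a pair determines the permutation, since a
monotone bijection inside each cell is forced. A permutation has polynomially many griddings, so
counting pairs of words gives the growth rate.

There are polynomially many letter contents, so up to such a factor the number of pairs is the
maximum over contents of a product of two rearrangement counts, `maxRearrangements`. This is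
supermultiplicative under concatenation, and Fekete's lemma gives the limit.

For positive weights `x`, `y` on cells, expanding a product of sums shows that the limit is at most
any `c` with (column sum of `x`) * (row sum of `y`) ≤ `c * x e * y e` at each cell `e`
(`maxRearrangements_le_pow`). In a tree with `m` edges, let `x e` and `y e` be the numbers of
vertices on the row side and the column side of the edge `e`. Sums around a vertex are at most `m`,
and `x e + y e = m + 1` gives `x e * y e ≥ m`, so `c = m` works. If the tree is not a star, raising
the weights at leaf edges makes all these inequalities strict (`sum_mul_sum_lt_of_not_isStar`), so
the rate is below `m`. In a star one of the two order conditions is vacuous and every word occurs,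
which gives at least `m ^ k` pairs. -/

namespace MonotoneGrid

/-! ### Counting pairs of words through rearrangements of a fixed content -/

section Words

variable {k l : ℕ} {E C D : Type*}

/-- The rearrangements of the word `f` that have the same colour as `f` at every position. -/
def rearrangements (col : E → C) (f : Fin k → E) : Set (Fin k → E) :=
  {g | col ∘ g = col ∘ f ∧ ∃ s : Equiv.Perm (Fin k), g = f ∘ s}

lemma ncard_le_mul_card_of_fiber {α β : Type*} [Finite α] [Finite β] (s : Set α) (φ : α → β)
    (n : ℕ) (h : ∀ a ∈ s, {x ∈ s | φ x = φ a}.ncard ≤ n) : s.ncard ≤ n * Nat.card β := by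
  classical
  have := Fintype.ofFinite α
  have := Fintype.ofFinite β
  have h1 : s.toFinset.card ≤ n * (s.toFinset.image φ).card := by
    refine Finset.card_le_mul_card_image _ n fun b hb => ?_
    obtain ⟨a, ha, rfl⟩ := Finset.mem_image.1 hb
    refine le_trans (le_of_eq ?_) (h a (Set.mem_toFinset.1 ha))
    rw [Set.ncard_eq_toFinset_card']
    congr 1
    ext x
    simp
  rw [Set.ncard_eq_toFinset_card', Nat.card_eq_fintype_card]
  exact h1.trans (Nat.mul_le_mul_left _ (Finset.card_le_univ _))

lemma exists_perm_of_card_fiber {α : Type*} {f g : Fin k → α}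
    (h : ∀ a, Nat.card {p // f p = a} = Nat.card {p // g p = a}) :
    ∃ s : Equiv.Perm (Fin k), f = g ∘ s :=
  ⟨Equiv.ofFiberEquiv fun a => (Finite.card_eq.1 (h a)).some,
    funext fun p => (Equiv.ofFiberEquiv_map _ p).symm⟩

/-- Permuting the positions of the whole picture is injective, so the count is controlled by the
letter content alone. -/
lemma ncard_rearrangements_comp_le [Finite E] (col : E → C) (f : Fin k → E)
    (s : Equiv.Perm (Fin k)) :
    (rearrangements col f).ncard ≤ (rearrangements col (f ∘ s)).ncard := by
  refine Set.ncard_le_ncard_of_injOn (fun g => g ∘ s) ?_ ?_ (Set.toFinite _)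
  · rintro g ⟨h1, s', rfl⟩
    refine ⟨?_, s⁻¹ * s' * s, ?_⟩
    · funext p
      exact congrFun h1 (s p)
    · funext p
      simp
  · intro g _ g' _ h
    exact s.surjective.injective_comp_right h

lemma ncard_rearrangements_append [Finite E] (col : E → C) (f : Fin k → E) (g : Fin l → E) :
    (rearrangements col f).ncard * (rearrangements col g).ncard ≤
      (rearrangements col (Fin.append f g)).ncard := by
  rw [← Set.ncard_prod]
  refine Set.ncard_le_ncard_of_injOn (fun w => Fin.append w.1 w.2) ?_ ?_ (Set.toFinite _)
  · rintro ⟨_, _⟩ ⟨⟨h1, s, rfl⟩, ⟨h2, s', rfl⟩⟩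
    refine ⟨?_, finSumFinEquiv.permCongr (Equiv.sumCongr s s'), ?_⟩
    · funext p
      refine Fin.addCases (fun i => ?_) (fun i => ?_) p
      · simpa using congrFun h1 i
      · simpa using congrFun h2 i
    · funext p
      refine Fin.addCases (fun i => ?_) (fun i => ?_) p <;> simp [Equiv.permCongr_apply]
  · rintro ⟨a, b⟩ _ ⟨a', b'⟩ _ h
    refine Prod.ext (funext fun i => ?_) (funext fun i => ?_)
    · simpa using congrFun h (Fin.castAdd l i)
    · simpa using congrFun h (Fin.natAdd k i)

/-- The largest number of pairs consisting of a rearrangement of a word of length `k` preserving the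
colouring `col` and a rearrangement preserving the colouring `row`. -/
noncomputable def maxRearrangements (col : E → C) (row : E → D) (k : ℕ) : ℕ :=
  ⨆ f : Fin k → E, (rearrangements col f).ncard * (rearrangements row f).ncard

lemma le_maxRearrangements [Finite E] (col : E → C) (row : E → D) (f : Fin k → E) :
    (rearrangements col f).ncard * (rearrangements row f).ncard ≤ maxRearrangements col row k :=
  le_ciSup (f := fun f : Fin k → E => (rearrangements col f).ncard * (rearrangements row f).ncard)
    (Set.finite_range _).bddAbove f

lemma exists_eq_maxRearrangements [Finite E] [Nonempty E] (col : E → C) (row : E → D) (k : ℕ) :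
    ∃ f : Fin k → E,
      (rearrangements col f).ncard * (rearrangements row f).ncard = maxRearrangements col row k :=
  exists_eq_ciSup_of_finite
    (f := fun f : Fin k → E => (rearrangements col f).ncard * (rearrangements row f).ncard)

lemma maxRearrangements_mul_le [Finite E] [Nonempty E] (col : E → C) (row : E → D) (k l : ℕ) :
    maxRearrangements col row k * maxRearrangements col row l ≤
      maxRearrangements col row (k + l) := by
  obtain ⟨f, hf⟩ := exists_eq_maxRearrangements col row k
  obtain ⟨g, hg⟩ := exists_eq_maxRearrangements col row l
  rw [← hf, ← hg, mul_mul_mul_comm]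
  exact (Nat.mul_le_mul (ncard_rearrangements_append col f g)
    (ncard_rearrangements_append row f g)).trans (le_maxRearrangements col row _)

lemma self_mem_rearrangements (col : E → C) (f : Fin k → E) : f ∈ rearrangements col f :=
  ⟨rfl, 1, by simp⟩

lemma maxRearrangements_pos [Finite E] [Nonempty E] (col : E → C) (row : E → D) (k : ℕ) :
    0 < maxRearrangements col row k := by
  refine lt_of_lt_of_le ?_ (le_maxRearrangements col row fun _ => Classical.arbitrary E)
  exact Nat.mul_pos ((Set.ncard_pos (Set.toFinite _)).2 ⟨_, self_mem_rearrangements _ _⟩)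
    ((Set.ncard_pos (Set.toFinite _)).2 ⟨_, self_mem_rearrangements _ _⟩)

/-- Pairs of words that are rearrangements of each other, the first one with increasing `col` and
the second one with increasing `row`. -/
def wordPairs [Preorder C] [Preorder D] (col : E → C) (row : E → D) (k : ℕ) :
    Set ((Fin k → E) × (Fin k → E)) :=
  {w | Monotone (col ∘ w.1) ∧ Monotone (row ∘ w.2) ∧ ∃ s : Equiv.Perm (Fin k), w.1 = w.2 ∘ s}

/-- Sorting the positions of `f` by colour turns all colour-preserving rearrangements of `f` into
words of increasing colour; doing this separately for columns and rows is injective on pairs. -/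
lemma maxRearrangements_le_ncard_wordPairs [Finite E] [LinearOrder C] [LinearOrder D]
    (col : E → C) (row : E → D) (k : ℕ) :
    maxRearrangements col row k ≤ (wordPairs col row k).ncard := by
  refine ciSup_le' fun f => ?_
  rw [← Set.ncard_prod]
  set s := Tuple.sort (col ∘ f)
  set s' := Tuple.sort (row ∘ f)
  refine Set.ncard_le_ncard_of_injOn (fun w => (w.1 ∘ s, w.2 ∘ s')) ?_ ?_ (Set.toFinite _)
  · rintro ⟨_, _⟩ ⟨⟨h1, a, rfl⟩, ⟨h2, b, rfl⟩⟩
    refine ⟨?_, ?_, s'⁻¹ * b⁻¹ * a * s, ?_⟩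
    · rw [← Function.comp_assoc, h1]
      exact Tuple.monotone_sort _
    · rw [← Function.comp_assoc, h2]
      exact Tuple.monotone_sort _
    · funext p
      simp
  · rintro ⟨a, b⟩ _ ⟨a', b'⟩ _ h
    rw [Prod.mk.injEq] at h
    exact Prod.ext (s.surjective.injective_comp_right h.1) (s'.surjective.injective_comp_right h.2)

/-- The number of occurrences of each letter in a word. -/
noncomputable def letterCount {α : Type*} (f : Fin k → α) (a : α) : Fin (k + 1) :=
  ⟨Nat.card {p // f p = a}, Nat.lt_succ_of_le (by
    simpa using Nat.card_le_card_of_injective (Subtype.val : {p // f p = a} → Fin k)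
      Subtype.val_injective)⟩

lemma exists_perm_of_letterCount_eq {α : Type*} {f g : Fin k → α}
    (h : letterCount f = letterCount g) : ∃ s : Equiv.Perm (Fin k), f = g ∘ s :=
  exists_perm_of_card_fiber fun a => congrArg Fin.val (congrFun h a)

lemma eq_of_monotone_of_eq_comp_perm [PartialOrder C] {f g : Fin k → C} (hf : Monotone f)
    (hg : Monotone g) {s : Equiv.Perm (Fin k)} (h : f = g ∘ s) : f = g := by
  have := Tuple.unique_monotone (f := g) (σ := s) (τ := 1) (h ▸ hf) (by simpa using hg)
  simpa [← h] using this

/-- Group the pairs by letter content. Two words with the same content and increasing colours have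
the same colour at every position, so each group lies in a product of two sets of rearrangements. -/
lemma ncard_wordPairs_le [Finite E] [PartialOrder C] [PartialOrder D]
    (col : E → C) (row : E → D) (k : ℕ) :
    (wordPairs col row k).ncard ≤ maxRearrangements col row k * (k + 1) ^ Nat.card E := by
  have hc : Nat.card (E → Fin (k + 1)) = (k + 1) ^ Nat.card E := by
    rw [Nat.card_fun]
    simp
  rw [← hc]
  refine ncard_le_mul_card_of_fiber _ (fun w => letterCount w.1) _ ?_
  rintro ⟨f, h⟩ ⟨hf, hh, s, hs⟩
  have h1 : {x ∈ wordPairs col row k | letterCount x.1 = letterCount f} ⊆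
      rearrangements col f ×ˢ rearrangements row h := by
    rintro ⟨f', h'⟩ ⟨⟨hf', hh', s', hs'⟩, hx⟩
    obtain ⟨a, ha⟩ := exists_perm_of_letterCount_eq hx
    simp only at hf hh hs hf' hh' hs' ha
    have hb : h' = h ∘ (s * a * s'⁻¹ : Equiv.Perm (Fin k)) := by
      have : h' = f' ∘ (s'⁻¹ : Equiv.Perm (Fin k)) := by
        rw [hs']
        funext p
        simp
      rw [this, ha, hs]
      rfl
    refine ⟨⟨?_, a, ha⟩, ⟨?_, _, hb⟩⟩
    · exact eq_of_monotone_of_eq_comp_perm hf' hf (s := a) (by rw [ha]; rfl)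
    · exact eq_of_monotone_of_eq_comp_perm hh' hh (s := s * a * s'⁻¹)
        (by simp only; rw [hb]; rfl)
  refine (Set.ncard_le_ncard h1 (Set.toFinite _)).trans ?_
  rw [Set.ncard_prod]
  refine le_trans (Nat.mul_le_mul_left _ ?_) (le_maxRearrangements col row f)
  simp only at hs
  rw [hs]
  exact ncard_rearrangements_comp_le row h s

/-- A bound for the number of colour-preserving rearrangements in terms of weights of letters. -/
lemma ncard_rearrangements_mul_prod_le [Fintype E] [DecidableEq C] (col : E → C) (x : E → ℝ)
    (hx : ∀ e, 0 ≤ x e) (f : Fin k → E) :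
    ((rearrangements col f).ncard : ℝ) * ∏ p, x (f p) ≤
      ∏ p, ∑ e with col e = col (f p), x e := by
  classical
  -- Expanded, the right side sums the weights of all words with the colours of `f`; each
  -- rearrangement of `f` is one of them and has the same weight as `f`.
  rw [Finset.prod_univ_sum, Set.ncard_eq_toFinset_card', ← nsmul_eq_mul, ← Finset.sum_const]
  have h1 : ∀ g ∈ (rearrangements col f).toFinset, ∏ p, x (f p) = ∏ p, x (g p) := by
    intro g hg
    obtain ⟨-, s, rfl⟩ := Set.mem_toFinset.1 hg
    exact (Equiv.prod_comp s fun p => x (f p)).symm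
  rw [Finset.sum_congr rfl h1]
  refine Finset.sum_le_sum_of_subset_of_nonneg ?_ fun g _ _ => Finset.prod_nonneg fun p _ => hx _
  intro g hg
  rw [Fintype.mem_piFinset]
  intro p
  simpa using congrFun (Set.mem_toFinset.1 hg).1 p

/-- Multiply the weight bounds for the two colourings and apply `h` at every position; the positive
product of the weights along `f` then cancels. -/
lemma maxRearrangements_le_pow [Fintype E] [Nonempty E] [DecidableEq C] [DecidableEq D]
    (col : E → C) (row : E → D) (x y : E → ℝ) (hx : ∀ e, 0 < x e) (hy : ∀ e, 0 < y e) (c : ℝ)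
    (h : ∀ e, (∑ e' with col e' = col e, x e') * (∑ e' with row e' = row e, y e') ≤
      c * (x e * y e)) (k : ℕ) : (maxRearrangements col row k : ℝ) ≤ c ^ k := by
  obtain ⟨f, hf⟩ := exists_eq_maxRearrangements col row k
  have h1 := mul_le_mul (ncard_rearrangements_mul_prod_le col x (fun e => (hx e).le) f)
    (ncard_rearrangements_mul_prod_le row y (fun e => (hy e).le) f)
    (mul_nonneg (Nat.cast_nonneg _) (Finset.prod_nonneg fun p _ => (hy _).le))
    (Finset.prod_nonneg fun p _ => Finset.sum_nonneg fun e _ => (hx e).le)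
  rw [← Finset.prod_mul_distrib] at h1
  have h2 : ∏ p, ((∑ e with col e = col (f p), x e) * ∑ e with row e = row (f p), y e) ≤
      ∏ p, (c * (x (f p) * y (f p))) :=
    Finset.prod_le_prod (fun p _ => mul_nonneg (Finset.sum_nonneg fun e _ => (hx e).le)
      (Finset.sum_nonneg fun e _ => (hy e).le)) fun p _ => h (f p)
  have h3 := h1.trans h2
  rw [Finset.prod_mul_distrib, Finset.prod_const, Finset.card_univ, Fintype.card_fin,
    mul_mul_mul_comm, ← Finset.prod_mul_distrib] at h3
  have h4 := le_of_mul_le_mul_right h3 (Finset.prod_pos fun p _ => mul_pos (hx _) (hy _))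
  rw [← hf]
  exact_mod_cast h4

end Words

end MonotoneGrid

namespace MonotoneGrid

/-! ### Existence and comparison of exponential growth rates -/

section GrowthRate

variable {E C D : Type*}

/-- Fekete's lemma for minus the logarithm; constant weights give the exponential bound that makes
the limit finite. -/
lemma exists_tendsto_maxRearrangements [Finite E] [Nonempty E] (col : E → C) (row : E → D) :
    ∃ L : ℝ, Tendsto (fun k : ℕ => (maxRearrangements col row k : ℝ) ^ (1 / (k : ℝ))) atTop
      (𝓝 L) := by
  classical
  have := Fintype.ofFinite E
  have hpos : ∀ k, (0 : ℝ) < maxRearrangements col row k := fun k =>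
    Nat.cast_pos.2 (maxRearrangements_pos col row k)
  set c : ℝ := (Fintype.card E : ℝ) * Fintype.card E with hc
  have hcard : (1 : ℝ) ≤ Fintype.card E := by exact_mod_cast Fintype.card_pos (α := E)
  have hc1 : 1 ≤ c := one_le_mul_of_one_le_of_one_le hcard hcard
  have hbound : ∀ k, (maxRearrangements col row k : ℝ) ≤ c ^ k := by
    refine maxRearrangements_le_pow col row (fun _ => 1) (fun _ => 1) (fun _ => one_pos)
      (fun _ => one_pos) c fun e => ?_
    simp only [Finset.sum_const, nsmul_eq_mul, mul_one]
    exact mul_le_mul (Nat.cast_le.2 (Finset.card_le_univ _)) (Nat.cast_le.2 (Finset.card_le_univ _))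
      (Nat.cast_nonneg _) (Nat.cast_nonneg _)
  have hsub : Subadditive fun k => -Real.log (maxRearrangements col row k) := by
    intro k l
    have h1 : (maxRearrangements col row k : ℝ) * maxRearrangements col row l ≤
        maxRearrangements col row (k + l) := by
      exact_mod_cast maxRearrangements_mul_le col row k l
    have h2 := Real.log_le_log (mul_pos (hpos k) (hpos l)) h1
    rw [Real.log_mul (hpos k).ne' (hpos l).ne'] at h2
    linarith
  have hbdd : BddBelow (Set.range fun k : ℕ =>
      -Real.log (maxRearrangements col row k) / (k : ℝ)) := by
    refine ⟨-Real.log c, ?_⟩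
    rintro _ ⟨k, rfl⟩
    -- At `k = 0` the quotient is `0` by convention, so the bound needs `1 ≤ c`.
    rcases Nat.eq_zero_or_pos k with rfl | hk
    · simpa using Real.log_nonneg hc1
    · have hk' : (0 : ℝ) < k := Nat.cast_pos.2 hk
      have h2 := Real.log_le_log (hpos k) (hbound k)
      rw [Real.log_pow] at h2
      simp only
      rw [le_div_iff₀ hk']
      linarith
  refine ⟨_, ((Real.continuous_exp.tendsto _).comp (hsub.tendsto_lim hbdd).neg).congr fun k => ?_⟩
  rw [Function.comp_apply, Real.rpow_def_of_pos (hpos k)]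
  congr 1
  ring

lemma tendsto_pow_rpow_one_div (A : ℕ) :
    Tendsto (fun k : ℕ => (((k : ℝ) + 1) ^ A) ^ (1 / (k : ℝ))) atTop (𝓝 1) := by
  -- The limit of `x ^ (A / (x - 1))` at `x = k + 1`, whose exponent is `A / k`.
  have h1 := (tendsto_rpow_div_mul_add (A : ℝ) 1 (-1) zero_ne_one).comp
    (tendsto_atTop_add_const_right atTop (1 : ℝ) tendsto_natCast_atTop_atTop)
  refine h1.congr fun k => ?_
  have hk : (0 : ℝ) ≤ (k : ℝ) + 1 := by positivity
  rw [Function.comp_apply, ← Real.rpow_natCast, ← Real.rpow_mul hk]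
  congr 1
  rw [mul_one_div]
  ring

/-- Sequences that differ by polynomial factors have the same growth rate. -/
lemma tendsto_rpow_of_polynomial_bounds {a b : ℕ → ℕ} {A B : ℕ} {L : ℝ}
    (hba : ∀ k, b k ≤ a k * (k + 1) ^ A) (hab : ∀ k, a k ≤ b k * (k + 1) ^ B)
    (h : Tendsto (fun k : ℕ => (b k : ℝ) ^ (1 / (k : ℝ))) atTop (𝓝 L)) :
    Tendsto (fun k : ℕ => (a k : ℝ) ^ (1 / (k : ℝ))) atTop (𝓝 L) := by
  have hl := h.div (tendsto_pow_rpow_one_div A) one_ne_zero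
  have hu := h.mul (tendsto_pow_rpow_one_div B)
  rw [div_one] at hl
  rw [mul_one] at hu
  refine tendsto_of_tendsto_of_tendsto_of_le_of_le hl hu (fun k => ?_) fun k => ?_
  · have hk : (0 : ℝ) ≤ ((k : ℝ) + 1) ^ A := by positivity
    simp only [Pi.div_apply]
    rw [← Real.div_rpow (Nat.cast_nonneg _) hk]
    refine Real.rpow_le_rpow (by positivity) ?_ (by positivity)
    rw [div_le_iff₀ (by positivity)]
    exact_mod_cast hba k
  · have hk : (0 : ℝ) ≤ ((k : ℝ) + 1) ^ B := by positivity
    simp only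
    rw [← Real.mul_rpow (Nat.cast_nonneg _) hk]
    exact Real.rpow_le_rpow (by positivity) (by exact_mod_cast hab k) (by positivity)

lemma le_of_tendsto_of_le_pow {a : ℕ → ℕ} {L c : ℝ} (hc : 0 ≤ c) (h : ∀ k, (a k : ℝ) ≤ c ^ k)
    (hL : Tendsto (fun k : ℕ => (a k : ℝ) ^ (1 / (k : ℝ))) atTop (𝓝 L)) : L ≤ c := by
  refine le_of_tendsto hL ?_
  filter_upwards [eventually_ne_atTop 0] with k hk
  calc (a k : ℝ) ^ (1 / (k : ℝ)) ≤ (c ^ k) ^ (1 / (k : ℝ)) :=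
        Real.rpow_le_rpow (Nat.cast_nonneg _) (h k) (by positivity)
    _ = c := by rw [one_div, Real.pow_rpow_inv_natCast hc hk]

lemma le_of_tendsto_of_pow_le {a : ℕ → ℕ} {L c : ℝ} (hc : 0 ≤ c) (h : ∀ k, c ^ k ≤ (a k : ℝ))
    (hL : Tendsto (fun k : ℕ => (a k : ℝ) ^ (1 / (k : ℝ))) atTop (𝓝 L)) : c ≤ L := by
  refine ge_of_tendsto hL ?_
  filter_upwards [eventually_ne_atTop 0] with k hk
  calc c = (c ^ k) ^ (1 / (k : ℝ)) := by rw [one_div, Real.pow_rpow_inv_natCast hc hk]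
    _ ≤ (a k : ℝ) ^ (1 / (k : ℝ)) :=
        Real.rpow_le_rpow (pow_nonneg hc _) (h k) (by positivity)

end GrowthRate

end MonotoneGrid

namespace MonotoneGrid

/-! ### Gridded permutations and pairs of words -/

section Grid

variable {t u k : ℕ}

/-- The non-zero cells of a matrix. -/
abbrev Cell (M : Matrix (Fin t) (Fin u) SignType) : Type :=
  {e : Fin t × Fin u // M e.1 e.2 ≠ 0}

/-- The column of a cell. -/
def Cell.col {M : Matrix (Fin t) (Fin u) SignType} (e : Cell M) : Fin t := e.1.1

/-- The row of a cell. -/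
def Cell.row {M : Matrix (Fin t) (Fin u) SignType} (e : Cell M) : Fin u := e.1.2

/-- The pair of words `w` records the cells of the points of `σ` ordered by position and by value,
and `σ` is monotone on each cell as prescribed by `M`. -/
structure IsWordPair (M : Matrix (Fin t) (Fin u) SignType) (σ : Equiv.Perm (Fin k))
    (w : (Fin k → Cell M) × (Fin k → Cell M)) : Prop where
  comp_eq : w.1 = w.2 ∘ σ
  increasing : ∀ e : Cell M, M e.1.1 e.1.2 = 1 → StrictMonoOn σ {p | w.1 p = e}
  decreasing : ∀ e : Cell M, M e.1.1 e.1.2 = -1 → StrictAntiOn σ {p | w.1 p = e}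

lemma exists_between_dividers {t : ℕ} {c : Fin (t + 1) → ℕ} {p : ℕ} (h0 : c 0 ≤ p)
    (h : p < c (Fin.last t)) : ∃ i : Fin t, c i.castSucc ≤ p ∧ p < c i.succ := by
  by_contra! hc
  exact absurd (Fin.induction (motive := fun i => c i ≤ p) h0 hc (Fin.last t)) (not_le.2 h)

lemma monotone_of_between_dividers {c : Fin (t + 1) → ℕ} (hc : Monotone c) {γ : Fin k → Fin t}
    (h : ∀ p, c (γ p).castSucc ≤ (p : ℕ) ∧ (p : ℕ) < c (γ p).succ) : Monotone γ := by
  intro p q hpq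
  by_contra! hlt
  have h1 : c (γ q).succ ≤ c (γ p).castSucc := hc (Fin.castSucc_lt_iff_succ_le.1 hlt)
  have h2 : (p : ℕ) ≤ q := hpq
  have h3 := (h p).1
  have h4 := (h q).2
  omega

lemma exists_isWordPair {M : Matrix (Fin t) (Fin u) SignType} {σ : Equiv.Perm (Fin k)}
    (hσ : σ ∈ gridClass M k) : ∃ w ∈ wordPairs Cell.col Cell.row k, IsWordPair M σ w := by
  obtain ⟨c, r, h⟩ := hσ
  choose γ hγ using fun p : Fin k => exists_between_dividers (c := c) (p := p)
    (by simp [h.col_zero]) (by simp [h.col_last])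
  choose ρ hρ using fun p : Fin k => exists_between_dividers (c := r) (p := p)
    (by simp [h.row_zero]) (by simp [h.row_last])
  have hne : ∀ p, M (γ p) (ρ (σ p)) ≠ 0 := by
    intro p h0
    have : p ∈ (∅ : Set (Fin k)) := h.empty _ _ h0 ▸ ⟨hγ p, hρ (σ p)⟩
    exact this
  refine ⟨(fun p => ⟨(γ p, ρ (σ p)), hne p⟩,
    fun q => ⟨(γ (σ.symm q), ρ q), by simpa using hne (σ.symm q)⟩), ⟨?_, ?_, σ, ?_⟩, ?_, ?_, ?_⟩
  · exact monotone_of_between_dividers h.col_mono hγ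
  · exact monotone_of_between_dividers h.row_mono hρ
  · funext p
    simp
  · funext p
    simp
  · intro e he
    refine (h.increasing _ _ he).mono ?_
    rintro p rfl
    exact ⟨hγ p, hρ (σ p)⟩
  · intro e he
    refine (h.decreasing _ _ he).mono ?_
    rintro p rfl
    exact ⟨hγ p, hρ (σ p)⟩

lemma IsWordPair.range_restrict {M : Matrix (Fin t) (Fin u) SignType} {σ : Equiv.Perm (Fin k)}
    {w : (Fin k → Cell M) × (Fin k → Cell M)} (h : IsWordPair M σ w) (e : Cell M) :
    Set.range (fun p : {p // w.1 p = e} => σ p) = {q | w.2 q = e} := by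
  ext q
  constructor
  · rintro ⟨⟨p, hp⟩, rfl⟩
    exact (congrFun h.comp_eq p).symm.trans hp
  · intro hq
    refine ⟨⟨σ.symm q, (congrFun h.comp_eq _).trans ?_⟩, by simp⟩
    simpa using hq

/-- The words fix the domain and the range of the permutation on each cell, and a strictly monotone
map on a finite chain is determined by its range. -/
lemma IsWordPair.perm_unique {M : Matrix (Fin t) (Fin u) SignType} {σ τ : Equiv.Perm (Fin k)}
    {w : (Fin k → Cell M) × (Fin k → Cell M)} (hσ : IsWordPair M σ w) (hτ : IsWordPair M τ w) :
    σ = τ := by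
  ext1 p
  have hr := (hσ.range_restrict (w.1 p)).trans (hτ.range_restrict (w.1 p)).symm
  suffices h : (fun q : {q // w.1 q = w.1 p} => σ q) = fun q : {q // w.1 q = w.1 p} => τ q from
    congrFun h ⟨p, rfl⟩
  rcases SignType.trichotomy (M (w.1 p).1.1 (w.1 p).1.2) with h | h | h
  · refine (StrictAnti.range_inj ?_ ?_).1 hr
    · exact fun a b hab => hσ.decreasing _ h a.2 b.2 hab
    · exact fun a b hab => hτ.decreasing _ h a.2 b.2 hab
  · exact absurd h (w.1 p).2
  · refine (StrictMono.range_inj ?_ ?_).1 hr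
    · exact fun a b hab => hσ.increasing _ h a.2 b.2 hab
    · exact fun a b hab => hτ.increasing _ h a.2 b.2 hab

lemma ncard_gridClass_le_ncard_wordPairs (M : Matrix (Fin t) (Fin u) SignType) (k : ℕ) :
    (gridClass M k).ncard ≤
      (wordPairs (Cell.col (M := M)) (Cell.row (M := M)) k).ncard := by
  choose w hw hw' using fun σ : gridClass M k => exists_isWordPair σ.2
  rw [← Nat.card_coe_set_eq, ← Nat.card_coe_set_eq]
  refine Nat.card_le_card_of_injective (fun σ => ⟨w σ, hw σ⟩) fun σ τ h => ?_
  have h1 : w σ = w τ := congrArg Subtype.val h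
  exact Subtype.ext ((hw' σ).perm_unique (h1 ▸ hw' τ))

lemma exists_equiv_strictMono_strictAnti {α β : Type*} [LinearOrder α] [LinearOrder β] [Finite α]
    [Finite β] (h : Nat.card α = Nat.card β) :
    (∃ φ : α ≃ β, StrictMono φ) ∧ ∃ φ : α ≃ β, StrictAnti φ := by
  have := Fintype.ofFinite α
  have := Fintype.ofFinite β
  rw [Nat.card_eq_fintype_card, Nat.card_eq_fintype_card] at h
  let a := Fintype.orderIsoFinOfCardEq α rfl
  let b := Fintype.orderIsoFinOfCardEq β h.symm
  refine ⟨⟨(a.symm.trans b).toEquiv, (a.symm.trans b).strictMono⟩,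
    ⟨(a.symm.toEquiv.trans Fin.revPerm).trans b.toEquiv, fun x y hxy => ?_⟩⟩
  simpa using hxy

/-- The dividers of a word: the `i`-th one is the number of letters before `i`. -/
def dividers (γ : Fin k → Fin t) (i : Fin (t + 1)) : ℕ :=
  (Finset.univ.filter fun p => (γ p).castSucc < i).card

lemma dividers_mono (γ : Fin k → Fin t) : Monotone (dividers γ) := fun _ _ hij =>
  Finset.card_le_card fun _ hp => by
    simp only [Finset.mem_filter, Finset.mem_univ, true_and] at hp ⊢
    exact hp.trans_le hij

lemma dividers_zero (γ : Fin k → Fin t) : dividers γ 0 = 0 := by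
  simp [dividers]

lemma dividers_last (γ : Fin k → Fin t) : dividers γ (Fin.last t) = k := by
  simp [dividers, Fin.castSucc_lt_last]

lemma between_dividers_iff {γ : Fin k → Fin t} (hγ : Monotone γ) (p : Fin k) (i : Fin t) :
    dividers γ i.castSucc ≤ (p : ℕ) ∧ (p : ℕ) < dividers γ i.succ ↔ γ p = i := by
  have h : ∀ j, (p : ℕ) < dividers γ j ↔ (γ p).castSucc < j := fun j =>
    Tuple.lt_card_lt_iff_apply_lt_of_monotone (f := fun p => (γ p).castSucc) (a := j) (j := p)
      fun a b hab => hγ hab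
  rw [← not_lt, h, h, not_lt]
  simp only [Fin.castSucc_le_castSucc_iff, Fin.castSucc_lt_succ_iff]
  exact ⟨fun h => le_antisymm h.2 h.1, fun h => ⟨h.ge, h.le⟩⟩

/-- Each letter occurs equally often in both words, so its positions can be matched monotonically in
the direction prescribed by `M`; these matchings glue to a permutation, gridded by the
letter-counting dividers. -/
lemma exists_mem_gridClass_isWordPair {M : Matrix (Fin t) (Fin u) SignType}
    {w : (Fin k → Cell M) × (Fin k → Cell M)} (hw : w ∈ wordPairs Cell.col Cell.row k) :
    ∃ σ ∈ gridClass M k, IsWordPair M σ w := by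
  obtain ⟨hcol, hrow, s, hs⟩ := hw
  have hcard : ∀ e, Nat.card {p // w.1 p = e} = Nat.card {q // w.2 q = e} := fun e =>
    Nat.card_congr (s.subtypeEquiv fun p => by rw [hs]; rfl)
  have hex : ∀ e : Cell M, ∃ φ : {p // w.1 p = e} ≃ {q // w.2 q = e},
      (M e.1.1 e.1.2 = 1 → StrictMono φ) ∧ (M e.1.1 e.1.2 = -1 → StrictAnti φ) := by
    intro e
    obtain ⟨⟨φ, hφ⟩, ⟨ψ, hψ⟩⟩ := exists_equiv_strictMono_strictAnti (hcard e)
    by_cases h : M e.1.1 e.1.2 = 1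
    · exact ⟨φ, fun _ => hφ, fun h' => absurd (h.symm.trans h') (by decide)⟩
    · exact ⟨ψ, fun h' => absurd h' h, fun _ => hψ⟩
  choose φ hφ hφ' using hex
  let σ : Equiv.Perm (Fin k) := Equiv.ofFiberEquiv φ
  have hval : ∀ e q (hq : w.1 q = e), σ q = φ e ⟨q, hq⟩ := by
    rintro e q rfl
    rfl
  have hσ : IsWordPair M σ w := by
    refine ⟨funext fun p => (Equiv.ofFiberEquiv_map φ p).symm, ?_, ?_⟩
    · rintro e he p rfl q hq hpq
      rw [hval _ p rfl, hval _ q hq]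
      exact hφ _ he (a := ⟨p, rfl⟩) (b := ⟨q, hq⟩) hpq
    · rintro e he p rfl q hq hpq
      rw [hval _ p rfl, hval _ q hq]
      exact hφ' _ he (a := ⟨p, rfl⟩) (b := ⟨q, hq⟩) hpq
  have hmem : ∀ i j, ∀ p ∈ {p : Fin k |
      (dividers (Cell.col ∘ w.1) i.castSucc ≤ (p : ℕ) ∧
        (p : ℕ) < dividers (Cell.col ∘ w.1) i.succ) ∧
      dividers (Cell.row ∘ w.2) j.castSucc ≤ (σ p : ℕ) ∧
        (σ p : ℕ) < dividers (Cell.row ∘ w.2) j.succ}, (w.1 p).1 = (i, j) := by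
    rintro i j p ⟨h1, h2⟩
    rw [between_dividers_iff hcol] at h1
    rw [between_dividers_iff hrow] at h2
    refine Prod.ext h1 ?_
    rw [hσ.comp_eq]
    exact h2
  refine ⟨σ, ⟨dividers (Cell.col ∘ w.1), dividers (Cell.row ∘ w.2), dividers_mono _,
    dividers_zero _, dividers_last _, dividers_mono _, dividers_zero _, dividers_last _,
    ?_, ?_, ?_⟩, hσ⟩
  · intro i j h
    exact (hσ.increasing ⟨(i, j), by simp [h]⟩ h).mono fun p hp => Subtype.ext (hmem i j p hp)
  · intro i j h
    exact (hσ.decreasing ⟨(i, j), by simp [h]⟩ h).mono fun p hp => Subtype.ext (hmem i j p hp)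
  · intro i j h
    refine Set.eq_empty_of_forall_notMem fun p hp => (w.1 p).2 ?_
    rw [hmem i j p hp]
    exact h

/-- The column and row counts play the role of the dividers: they determine the two sorted colour
words, and with `σ` these give the column and row of every point, hence both words. -/
lemma ncard_wordPairs_le_ncard_gridClass (M : Matrix (Fin t) (Fin u) SignType) (k : ℕ) :
    (wordPairs (Cell.col (M := M)) (Cell.row (M := M)) k).ncard ≤
      (gridClass M k).ncard * (k + 1) ^ (t + u) := by
  choose σ hσ hσ' using fun w : wordPairs (Cell.col (M := M)) (Cell.row (M := M)) k =>
    exists_mem_gridClass_isWordPair w.2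
  have hc : Nat.card ((Fin t → Fin (k + 1)) × (Fin u → Fin (k + 1))) = (k + 1) ^ (t + u) := by
    simp [pow_add]
  rw [← Nat.card_coe_set_eq, ← Nat.card_coe_set_eq, ← hc, ← Nat.card_prod]
  refine Nat.card_le_card_of_injective (fun w => (⟨σ w, hσ w⟩,
    letterCount (Cell.col ∘ w.1.1), letterCount (Cell.row ∘ w.1.2))) fun w w' h => ?_
  simp only [Prod.mk.injEq, Subtype.mk.injEq] at h
  obtain ⟨h1, h2, h3⟩ := h
  obtain ⟨s, hs⟩ := exists_perm_of_letterCount_eq h2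
  obtain ⟨s', hs'⟩ := exists_perm_of_letterCount_eq h3
  have hcol := eq_of_monotone_of_eq_comp_perm w.2.1 w'.2.1 hs
  have hrow := eq_of_monotone_of_eq_comp_perm w.2.2.1 w'.2.2.1 hs'
  have hfst : w.1.1 = w'.1.1 := by
    funext p
    refine Subtype.ext (Prod.ext (congrFun hcol p) ?_)
    have h4 := congrFun hrow (σ w p)
    rw [(hσ' w).comp_eq, (hσ' w').comp_eq, ← h1]
    exact h4
  refine Subtype.ext (Prod.ext hfst ?_)
  apply (σ w).surjective.injective_comp_right
  simp only
  rw [← (hσ' w).comp_eq, hfst, h1, ← (hσ' w').comp_eq]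

lemma hasGrowthRate_gridClass {M : Matrix (Fin t) (Fin u) SignType} {L : ℝ}
    (h : Tendsto (fun k : ℕ => (maxRearrangements (Cell.col (M := M)) (Cell.row (M := M)) k : ℝ) ^
      (1 / (k : ℝ))) atTop (𝓝 L)) : HasGrowthRate (gridClass M) L := by
  refine tendsto_rpow_of_polynomial_bounds (A := t + u) (B := Nat.card (Cell M))
    (fun k => ?_) (fun k => ?_) h
  · exact (maxRearrangements_le_ncard_wordPairs _ _ k).trans
      (ncard_wordPairs_le_ncard_gridClass M k)
  · exact (ncard_gridClass_le_ncard_wordPairs M k).trans (ncard_wordPairs_le _ _ k)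

end Grid

end MonotoneGrid

namespace MonotoneGrid

/-! ### Branch sizes in trees, and stars -/

section Trees

variable {V : Type*} {G : SimpleGraph V}

/-- The number of vertices that are closer to `w` than to `v`. -/
noncomputable def branchCard (G : SimpleGraph V) (v w : V) : ℕ :=
  {z | G.dist z w < G.dist z v}.ncard

lemma branchCard_pos [Finite V] {v w : V} (h : G.Adj v w) : 1 ≤ branchCard G v w := by
  refine (Set.ncard_pos (Set.toFinite _)).2 ⟨w, ?_⟩
  simp only [Set.mem_ofPred_eq, SimpleGraph.dist_self]
  rw [SimpleGraph.dist_eq_one_iff_adj.2 h.symm]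
  exact one_pos

/-- In a tree no vertex is equidistant from the two ends of an edge, so the two branches partition
the vertices. -/
lemma branchCard_add [Finite V] (hG : G.IsTree) {v w : V} (h : G.Adj v w) :
    branchCard G v w + branchCard G w v = Nat.card V := by
  rw [branchCard, branchCard, ← Set.ncard_univ, ← Set.ncard_union_eq]
  · congr 1
    ext z
    simpa using hG.dist_ne_of_adj z h.symm
  · rw [Set.disjoint_left]
    intro z hz hz'
    rw [Set.mem_ofPred_eq] at hz hz'
    exact lt_asymm hz hz'

lemma two_le_branchCard [Finite V] (hG : G.IsTree) {v w w' : V} (h : G.Adj v w) (h' : G.Adj w w')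
    (hne : w' ≠ v) : 2 ≤ branchCard G v w := by
  have h1 : G.dist w w = 0 := SimpleGraph.dist_self
  have h2 : G.dist w v = 1 := SimpleGraph.dist_eq_one_iff_adj.2 h.symm
  have h3 : G.dist w' w = 1 := SimpleGraph.dist_eq_one_iff_adj.2 h'.symm
  have h4 := hG.dist_ne_of_adj w' h
  have h5 : G.dist w' v ≠ 0 := fun h0 => hne (hG.connected.dist_eq_zero_iff.1 h0)
  rw [← Set.ncard_pair h'.ne]
  refine Set.ncard_le_ncard ?_ (Set.toFinite _)
  rintro z (rfl | rfl)
  · simp only [Set.mem_ofPred_eq]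
    omega
  · simp only [Set.mem_ofPred_eq]
    omega

/-- A neighbour of `v` closer to `z` is the second vertex of a path from `v` to `z`, and that path
is unique. -/
lemma eq_of_adj_of_dist_lt (hG : G.IsTree) {v w w' z : V} (h : G.Adj v w) (h' : G.Adj v w')
    (hz : G.dist z w < G.dist z v) (hz' : G.dist z w' < G.dist z v) : w = w' := by
  have key : ∀ x, G.Adj v x → G.dist z x < G.dist z v →
      ∃ p : G.Walk v z, p.IsPath ∧ p.snd = x := by
    intro x hx hlt
    obtain ⟨q, hq⟩ := hG.connected.exists_walk_length_eq_dist x z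
    refine ⟨.cons hx q, SimpleGraph.Walk.isPath_of_length_eq_dist _ ?_, by simp⟩
    have h1 := SimpleGraph.dist_le (SimpleGraph.Walk.cons hx q)
    rw [SimpleGraph.Walk.length_cons, hq] at h1 ⊢
    rw [SimpleGraph.dist_comm, SimpleGraph.dist_comm (u := z)] at hlt
    omega
  obtain ⟨p, hp, rfl⟩ := key w h hz
  obtain ⟨q, hq, rfl⟩ := key w' h' hz'
  rw [(hG.existsUnique_path v z).unique hp hq]

/-- The branches at `v` are pairwise disjoint and none of them contains `v`. -/
lemma sum_branchCard_lt [Fintype V] (hG : G.IsTree) (v : V) (s : Finset V)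
    (hs : ∀ w ∈ s, G.Adj v w) : ∑ w ∈ s, branchCard G v w < Nat.card V := by
  classical
  have h1 : ∑ w ∈ s, branchCard G v w =
      (s.biUnion fun w => {z | G.dist z w < G.dist z v}.toFinset).card := by
    rw [Finset.card_biUnion]
    · exact Finset.sum_congr rfl fun w _ => Set.ncard_eq_toFinset_card' _
    · intro w hw w' hw' hne
      rw [Function.onFun, Finset.disjoint_left]
      intro z hz hz'
      simp only [Set.mem_toFinset] at hz hz'
      exact hne (eq_of_adj_of_dist_lt hG (hs w hw) (hs w' hw') hz hz')
  rw [h1, Nat.card_eq_fintype_card]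
  refine Finset.card_lt_univ_of_notMem (x := v) ?_
  simp

/-- If all neighbours of `v` have no neighbour except `v`, then all edges contain `v`. -/
lemma eq_or_eq_of_adj_of_forall_neighbor (hG : G.Connected) {v : V}
    (h : ∀ w, G.Adj v w → ∀ x, G.Adj w x → x = v) {a b : V} (hab : G.Adj a b) :
    a = v ∨ b = v := by
  have key : ∀ x, G.Reachable v x → x = v ∨ G.Adj v x := by
    intro x hx
    rw [SimpleGraph.reachable_iff_reflTransGen] at hx
    induction hx with
    | refl => exact Or.inl rfl
    | tail _ hyz ih =>
      rcases ih with rfl | ih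
      · exact Or.inr hyz
      · exact Or.inl (h _ ih _ hyz)
  rcases key a (hG.preconnected v a) with rfl | ha
  · exact Or.inl rfl
  · exact Or.inr (h a ha b hab)

lemma isStar_of_forall_adj [Finite V] {m : ℕ} (hG : G.Connected) (hm : Nat.card V = m + 1) (v : V)
    (h : ∀ a b, G.Adj a b → a = v ∨ b = v) : IsStar G m := by
  classical
  have := Fintype.ofFinite V
  have hv : ∀ x, x ≠ v → G.Adj v x := by
    intro x hx
    obtain ⟨p⟩ := hG.preconnected x v
    cases p with
    | nil => exact absurd rfl hx
    | cons hxy p =>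
      rcases h _ _ hxy with rfl | rfl
      · exact absurd rfl hx
      · exact hxy.symm
  have hadj : ∀ a b, G.Adj a b ↔ (a = v ∧ b ≠ v ∨ a ≠ v ∧ b = v) := by
    intro a b
    constructor
    · intro hab
      rcases h a b hab with rfl | rfl
      · exact Or.inl ⟨rfl, hab.ne'⟩
      · exact Or.inr ⟨hab.ne, rfl⟩
    · rintro (⟨rfl, hb⟩ | ⟨ha, rfl⟩)
      · exact hv b hb
      · exact (hv a ha).symm
  have h1 : Fintype.card {x // x = v} = Fintype.card (Fin 1) := by simp
  have h2 : Fintype.card {x // ¬ x = v} = Fintype.card (Fin m) := by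
    rw [Fintype.card_subtype_compl, h1, ← Nat.card_eq_fintype_card, hm]
    simp
  let φ : V ≃ Fin 1 ⊕ Fin m := (Equiv.sumCompl fun x => x = v).symm.trans
    (Equiv.sumCongr (Fintype.equivOfCardEq h1) (Fintype.equivOfCardEq h2))
  have hφ : ∀ x, (φ x).isLeft = true ↔ x = v := by
    intro x
    by_cases hx : x = v
    · simp [φ, hx, Equiv.sumCompl_symm_apply_of_pos]
    · simp [φ, hx, Equiv.sumCompl_symm_apply_of_neg]
  have hφ' : ∀ x, (φ x).isRight = true ↔ x ≠ v := by
    intro x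
    rw [Ne, ← hφ x]
    cases φ x <;> simp
  refine ⟨⟨φ, fun {a b} => ?_⟩⟩
  rw [hadj, completeBipartiteGraph_adj, hφ, hφ, hφ', hφ']

lemma IsStar.exists_forall_adj {m : ℕ} (h : IsStar G m) :
    ∃ v, ∀ a b, G.Adj a b → a = v ∨ b = v := by
  obtain ⟨φ⟩ := h
  have key : ∀ x, (φ x).isLeft = true → x = φ.symm (Sum.inl 0) := by
    intro x hx
    obtain ⟨i, hi⟩ := Sum.isLeft_iff.1 hx
    rw [Subsingleton.elim 0 i, ← hi]
    simp
  refine ⟨φ.symm (Sum.inl 0), fun a b hab => ?_⟩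
  rw [← φ.map_adj_iff, completeBipartiteGraph_adj] at hab
  exact hab.imp (fun h => key a h.1) fun h => key b h.2

end Trees

end MonotoneGrid

namespace MonotoneGrid

/-! ### Sums of branch weights over a colour class -/

section Weights

variable {V E C : Type*} [Fintype V] [Fintype E] [DecidableEq C] {G : SimpleGraph V} {m : ℕ}

lemma sum_branchCard_fiber_le (hG : G.IsTree) (hm : Nat.card V = m + 1) {col : E → C} {a b : E → V}
    (hadj : ∀ e, G.Adj (a e) (b e)) (hcol : ∀ e e', col e = col e' → a e = a e')
    (hinj : ∀ e e', col e = col e' → b e = b e' → e = e') (e₀ : E) :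
    ∑ e with col e = col e₀, (branchCard G (a e) (b e) : ℝ) ≤ m := by
  classical
  have h1 : ∑ e with col e = col e₀, branchCard G (a e) (b e) =
      ∑ w ∈ (Finset.univ.filter fun e => col e = col e₀).image b, branchCard G (a e₀) w := by
    rw [Finset.sum_image]
    · refine Finset.sum_congr rfl fun e he => ?_
      rw [hcol e e₀ (Finset.mem_filter.1 he).2]
    · intro e he e' he' h
      simp only [Finset.coe_filter, Finset.mem_univ, true_and, Set.mem_ofPred_eq] at he he'
      exact hinj e e' (he.trans he'.symm) h
  have h2 := sum_branchCard_lt hG (a e₀)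
    ((Finset.univ.filter fun e => col e = col e₀).image b) fun w hw => by
      obtain ⟨e, he, rfl⟩ := Finset.mem_image.1 hw
      rw [← hcol e e₀ (Finset.mem_filter.1 he).2]
      exact hadj e
  rw [← h1, hm] at h2
  exact_mod_cast Nat.le_of_lt_succ h2

lemma sum_branchCard_mul_le (hG : G.IsTree) (hm : Nat.card V = m + 1) {col : E → C} {a b : E → V}
    (hadj : ∀ e, G.Adj (a e) (b e)) (hcol : ∀ e e', col e = col e' → a e = a e')
    (hinj : ∀ e e', col e = col e' → b e = b e' → e = e') {φ : E → ℝ} {K : ℝ} (hK : 0 ≤ K)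
    (hφ : ∀ e, φ e ≤ K) (e₀ : E) :
    ∑ e with col e = col e₀, (branchCard G (a e) (b e) : ℝ) * φ e ≤ m * K := by
  refine le_trans (Finset.sum_le_sum fun e _ =>
    mul_le_mul_of_nonneg_left (hφ e) (Nat.cast_nonneg _)) ?_
  rw [← Finset.sum_mul]
  exact mul_le_mul_of_nonneg_right (sum_branchCard_fiber_le hG hm hadj hcol hinj e₀) hK

lemma sum_branchCard_mul_lt (hG : G.IsTree) (hm : Nat.card V = m + 1) {col : E → C} {a b : E → V}
    (hadj : ∀ e, G.Adj (a e) (b e)) (hcol : ∀ e e', col e = col e' → a e = a e')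
    (hinj : ∀ e e', col e = col e' → b e = b e' → e = e') {φ : E → ℝ} {K : ℝ} (hK : 0 ≤ K)
    (hφ : ∀ e, φ e ≤ K) {e₀ e₁ : E} (he₁ : col e₁ = col e₀) (hlt : φ e₁ < K) :
    ∑ e with col e = col e₀, (branchCard G (a e) (b e) : ℝ) * φ e < m * K := by
  have hpos : (0 : ℝ) < branchCard G (a e₁) (b e₁) := Nat.cast_pos.2 (branchCard_pos (hadj e₁))
  refine lt_of_lt_of_le (Finset.sum_lt_sum (fun e _ =>
    mul_le_mul_of_nonneg_left (hφ e) (Nat.cast_nonneg _))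
    ⟨e₁, by simpa using he₁, mul_lt_mul_of_pos_left hlt hpos⟩) ?_
  rw [← Finset.sum_mul]
  exact mul_le_mul_of_nonneg_right (sum_branchCard_fiber_le hG hm hadj hcol hinj e₀) hK

end Weights

/-! ### Weights on the row-column graph and the value of the growth rate -/

section RowColumnGraph

variable {t u m : ℕ} {M : Matrix (Fin t) (Fin u) SignType}

lemma rowColumnGraph_adj_inl_inr {i : Fin t} {j : Fin u} :
    (rowColumnGraph M).Adj (Sum.inl i) (Sum.inr j) ↔ M i j ≠ 0 := by
  simp [rowColumnGraph]

lemma rowColumnGraph_adj_inr_inl {i : Fin t} {j : Fin u} :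
    (rowColumnGraph M).Adj (Sum.inr j) (Sum.inl i) ↔ M i j ≠ 0 := by
  rw [SimpleGraph.adj_comm, rowColumnGraph_adj_inl_inr]

lemma not_rowColumnGraph_adj_inl_inl {i i' : Fin t} :
    ¬ (rowColumnGraph M).Adj (Sum.inl i) (Sum.inl i') := by
  simp [rowColumnGraph]

lemma not_rowColumnGraph_adj_inr_inr {j j' : Fin u} :
    ¬ (rowColumnGraph M).Adj (Sum.inr j) (Sum.inr j') := by
  simp [rowColumnGraph]

lemma Cell.adj (e : Cell M) : (rowColumnGraph M).Adj (Sum.inl e.col) (Sum.inr e.row) :=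
  rowColumnGraph_adj_inl_inr.2 e.2

lemma Cell.ext_col_row {e e' : Cell M} (h : e.col = e'.col) (h' : e.row = e'.row) : e = e' :=
  Subtype.ext (Prod.ext h h')

lemma gridSize_eq_card (M : Matrix (Fin t) (Fin u) SignType) : gridSize M = Nat.card (Cell M) := by
  rw [gridSize, Nat.card_eq_fintype_card, Fintype.card_subtype]

lemma card_edgeSet_rowColumnGraph (M : Matrix (Fin t) (Fin u) SignType) :
    Nat.card (rowColumnGraph M).edgeSet = gridSize M := by
  rw [gridSize_eq_card]
  refine (Nat.card_congr (Equiv.ofBijective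
    (fun e : Cell M => (⟨s(Sum.inl e.col, Sum.inr e.row), e.adj⟩ : (rowColumnGraph M).edgeSet))
    ⟨fun e e' h => ?_, ?_⟩)).symm
  · have h1 := congrArg Subtype.val h
    simp only [Sym2.eq_iff, Sum.inl.injEq, Sum.inr.injEq, reduceCtorEq, and_self, or_false] at h1
    exact Cell.ext_col_row h1.1 h1.2
  · rintro ⟨⟨x, y⟩, h⟩
    have h' : (rowColumnGraph M).Adj x y := h
    rcases x with i | j <;> rcases y with i' | j'
    · exact absurd h' not_rowColumnGraph_adj_inl_inl
    · exact ⟨⟨(i, j'), rowColumnGraph_adj_inl_inr.1 h'⟩, rfl⟩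
    · exact ⟨⟨(i', j), rowColumnGraph_adj_inr_inl.1 h'⟩, Subtype.ext Sym2.eq_swap⟩
    · exact absurd h' not_rowColumnGraph_adj_inr_inr

lemma card_vertices_of_isTree (hG : (rowColumnGraph M).IsTree) :
    Nat.card (Fin t ⊕ Fin u) = gridSize M + 1 := by
  rw [← card_edgeSet_rowColumnGraph]
  exact (SimpleGraph.isTree_iff_connected_and_card.1 hG).2.symm

/-- The weight of a cell with respect to its column. -/
noncomputable def colBranch (e : Cell M) : ℕ :=
  branchCard (rowColumnGraph M) (Sum.inl e.col) (Sum.inr e.row)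

/-- The weight of a cell with respect to its row. -/
noncomputable def rowBranch (e : Cell M) : ℕ :=
  branchCard (rowColumnGraph M) (Sum.inr e.row) (Sum.inl e.col)

lemma one_le_colBranch (e : Cell M) : (1 : ℝ) ≤ colBranch e :=
  Nat.one_le_cast.2 (branchCard_pos e.adj)

lemma one_le_rowBranch (e : Cell M) : (1 : ℝ) ≤ rowBranch e :=
  Nat.one_le_cast.2 (branchCard_pos e.adj.symm)

lemma colBranch_add_rowBranch (hG : (rowColumnGraph M).IsTree) (e : Cell M) :
    (colBranch e : ℝ) + rowBranch e = gridSize M + 1 := by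
  have h := branchCard_add hG e.adj
  rw [card_vertices_of_isTree hG] at h
  exact_mod_cast h

lemma sum_colBranch_mul_le (hG : (rowColumnGraph M).IsTree) {φ : Cell M → ℝ} {K : ℝ} (hK : 0 ≤ K)
    (hφ : ∀ e, φ e ≤ K) (e₀ : Cell M) :
    ∑ e with Cell.col e = e₀.col, (colBranch e : ℝ) * φ e ≤ gridSize M * K :=
  sum_branchCard_mul_le hG (card_vertices_of_isTree hG) (col := Cell.col)
    (a := fun e => Sum.inl e.col) (b := fun e => Sum.inr e.row) (fun e => e.adj)
    (fun _ _ h => congrArg _ h) (fun _ _ h h' => Cell.ext_col_row h (Sum.inr_injective h')) hK hφ e₀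

lemma sum_rowBranch_mul_le (hG : (rowColumnGraph M).IsTree) {φ : Cell M → ℝ} {K : ℝ} (hK : 0 ≤ K)
    (hφ : ∀ e, φ e ≤ K) (e₀ : Cell M) :
    ∑ e with Cell.row e = e₀.row, (rowBranch e : ℝ) * φ e ≤ gridSize M * K :=
  sum_branchCard_mul_le hG (card_vertices_of_isTree hG) (col := Cell.row)
    (a := fun e => Sum.inr e.row) (b := fun e => Sum.inl e.col) (fun e => e.adj.symm)
    (fun _ _ h => congrArg _ h) (fun _ _ h h' => Cell.ext_col_row (Sum.inl_injective h') h) hK hφ e₀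

lemma sum_colBranch_mul_lt (hG : (rowColumnGraph M).IsTree) {φ : Cell M → ℝ} {K : ℝ} (hK : 0 ≤ K)
    (hφ : ∀ e, φ e ≤ K) {e₀ e₁ : Cell M} (he₁ : e₁.col = e₀.col) (hlt : φ e₁ < K) :
    ∑ e with Cell.col e = e₀.col, (colBranch e : ℝ) * φ e < gridSize M * K :=
  sum_branchCard_mul_lt hG (card_vertices_of_isTree hG) (col := Cell.col)
    (a := fun e => Sum.inl e.col) (b := fun e => Sum.inr e.row) (fun e => e.adj)
    (fun _ _ h => congrArg _ h) (fun _ _ h h' => Cell.ext_col_row h (Sum.inr_injective h')) hK hφ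
    he₁ hlt

lemma sum_rowBranch_mul_lt (hG : (rowColumnGraph M).IsTree) {φ : Cell M → ℝ} {K : ℝ} (hK : 0 ≤ K)
    (hφ : ∀ e, φ e ≤ K) {e₀ e₁ : Cell M} (he₁ : e₁.row = e₀.row) (hlt : φ e₁ < K) :
    ∑ e with Cell.row e = e₀.row, (rowBranch e : ℝ) * φ e < gridSize M * K :=
  sum_branchCard_mul_lt hG (card_vertices_of_isTree hG) (col := Cell.row)
    (a := fun e => Sum.inr e.row) (b := fun e => Sum.inl e.col) (fun e => e.adj.symm)
    (fun _ _ h => congrArg _ h) (fun _ _ h h' => Cell.ext_col_row (Sum.inl_injective h') h) hK hφ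
    he₁ hlt

/-- A vertex is a leaf if it has at most one neighbour. -/
def IsLeaf {V : Type*} (G : SimpleGraph V) (v : V) : Prop :=
  ∀ x y, G.Adj v x → G.Adj v y → x = y

lemma exists_adj_not_isLeaf {V : Type*} [Finite V] {G : SimpleGraph V} (hG : G.Connected)
    (hm : Nat.card V = m + 1) (hs : ¬ IsStar G m) (v : V) : ∃ w, G.Adj v w ∧ ¬ IsLeaf G w := by
  by_contra! h
  exact hs (isStar_of_forall_adj hG hm v fun a b => eq_or_eq_of_adj_of_forall_neighbor hG
    fun w hw x hx => h w hw x v hx hw.symm)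

lemma two_le_branchCard_of_not_isLeaf {V : Type*} [Finite V] {G : SimpleGraph V} (hG : G.IsTree)
    {v w : V} (h : G.Adj v w) (hw : ¬ IsLeaf G w) : 2 ≤ branchCard G v w := by
  by_contra hlt
  have key : ∀ x, G.Adj w x → x = v := fun x hx => by
    by_contra hne
    exact hlt (two_le_branchCard hG h hx hne)
  exact hw fun x y hx hy => (key x hx).trans (key y hy).symm

lemma maxRearrangements_le_gridSize_pow [Nonempty (Cell M)] (hG : (rowColumnGraph M).IsTree)
    (k : ℕ) :
    (maxRearrangements (Cell.col (M := M)) (Cell.row (M := M)) k : ℝ) ≤ (gridSize M : ℝ) ^ k := by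
  refine maxRearrangements_le_pow _ _ (fun e => colBranch e) (fun e => rowBranch e)
    (fun e => one_pos.trans_le (one_le_colBranch e))
    (fun e => one_pos.trans_le (one_le_rowBranch e)) _ (fun e => ?_) k
  have h1 := sum_colBranch_mul_le hG zero_le_one (φ := fun _ => 1) (fun _ => le_rfl) e
  have h2 := sum_rowBranch_mul_le hG zero_le_one (φ := fun _ => 1) (fun _ => le_rfl) e
  simp only [mul_one] at h1 h2
  have h3 := one_le_colBranch e
  have h4 := one_le_rowBranch e
  have h5 := colBranch_add_rowBranch hG e
  have hm : (0 : ℝ) ≤ gridSize M := Nat.cast_nonneg _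
  refine (mul_le_mul h1 h2 (Finset.sum_nonneg fun _ _ => Nat.cast_nonneg _) hm).trans ?_
  refine mul_le_mul_of_nonneg_left ?_ hm
  -- `(x - 1) * (y - 1) ≥ 0` with `x + y = m + 1` gives `x * y ≥ m`.
  nlinarith

open Classical in
/-- The factor by which the weights of cells incident to leaves are increased. -/
noncomputable def leafFactor (e : Cell M) : ℝ :=
  if IsLeaf (rowColumnGraph M) (Sum.inl e.col) ∨ IsLeaf (rowColumnGraph M) (Sum.inr e.row)
  then 11 / 10 else 1

lemma one_le_leafFactor (e : Cell M) : 1 ≤ leafFactor e := by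
  unfold leafFactor
  split_ifs <;> norm_num

lemma leafFactor_le (e : Cell M) : leafFactor e ≤ 11 / 10 := by
  unfold leafFactor
  split_ifs <;> norm_num

lemma leafFactor_eq_one {e : Cell M} (h : ¬ IsLeaf (rowColumnGraph M) (Sum.inl e.col))
    (h' : ¬ IsLeaf (rowColumnGraph M) (Sum.inr e.row)) : leafFactor e = 1 :=
  if_neg (not_or.2 ⟨h, h'⟩)

lemma leafFactor_lt {e : Cell M} (h : ¬ IsLeaf (rowColumnGraph M) (Sum.inl e.col))
    (h' : ¬ IsLeaf (rowColumnGraph M) (Sum.inr e.row)) : leafFactor e < 11 / 10 := by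
  rw [leafFactor_eq_one h h']
  norm_num

/-- With unmodified weights, equality is possible only at leaf edges, where one branch has size 1.
The factor 11/10 gains there, because the non-leaf end also has a non-leaf neighbour whose edge is
not raised. Inner edges have enough slack to absorb the loss. -/
lemma sum_mul_sum_lt_of_not_isStar (hG : (rowColumnGraph M).IsTree)
    (hs : ¬ IsStar (rowColumnGraph M) (gridSize M)) (e : Cell M) :
    (∑ e' : Cell M with Cell.col e' = e.col, (colBranch e' : ℝ) * leafFactor e') *
        (∑ e' : Cell M with Cell.row e' = e.row, (rowBranch e' : ℝ) * leafFactor e') <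
      gridSize M * ((colBranch e * leafFactor e) * (rowBranch e * leafFactor e)) := by
  have h3 := one_le_colBranch e
  have h4 := one_le_rowBranch e
  have hm : (0 : ℝ) ≤ gridSize M := Nat.cast_nonneg _
  have hf := one_le_leafFactor e
  by_cases hrow : IsLeaf (rowColumnGraph M) (Sum.inr e.row)
  · have hsum : ∑ e' : Cell M with Cell.row e' = e.row, (rowBranch e' : ℝ) * leafFactor e' =
        rowBranch e * leafFactor e := by
      rw [Finset.sum_eq_single e]
      · intro e' he' hne
        have h5 := (Finset.mem_filter.1 he').2
        refine absurd (Cell.ext_col_row (Sum.inl_injective (hrow _ _ ?_ e.adj.symm)) h5) hne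
        rw [← h5]
        exact e'.adj.symm
      · simp
    have hfe : leafFactor e = 11 / 10 := if_pos (Or.inr hrow)
    obtain ⟨y, hy, hyl⟩ := exists_adj_not_isLeaf hG.connected (card_vertices_of_isTree hG) hs
      (Sum.inl e.col)
    rcases y with i | j
    · exact absurd hy not_rowColumnGraph_adj_inl_inl
    -- Otherwise the non-leaf neighbour `j` would be the only neighbour of the column, hence the
    -- leaf `e.row`.
    have hcol : ¬ IsLeaf (rowColumnGraph M) (Sum.inl e.col) := fun h =>
      hyl (h _ _ hy e.adj ▸ hrow)
    have h6 := sum_colBranch_mul_lt hG (K := 11 / 10) (by norm_num) leafFactor_le (e₀ := e)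
      (e₁ := ⟨(e.col, j), rowColumnGraph_adj_inl_inr.1 hy⟩) rfl
      (leafFactor_lt hcol hyl)
    rw [hsum, ← mul_assoc (gridSize M : ℝ)]
    refine mul_lt_mul_of_pos_right (h6.trans_le ?_) (by positivity)
    rw [hfe]
    exact mul_le_mul_of_nonneg_left (by linarith) hm
  by_cases hcol : IsLeaf (rowColumnGraph M) (Sum.inl e.col)
  · have hsum : ∑ e' : Cell M with Cell.col e' = e.col, (colBranch e' : ℝ) * leafFactor e' =
        colBranch e * leafFactor e := by
      rw [Finset.sum_eq_single e]
      · intro e' he' hne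
        have h5 := (Finset.mem_filter.1 he').2
        refine absurd (Cell.ext_col_row h5 (Sum.inr_injective (hcol _ _ ?_ e.adj))) hne
        rw [← h5]
        exact e'.adj
      · simp
    have hfe : leafFactor e = 11 / 10 := if_pos (Or.inl hcol)
    obtain ⟨y, hy, hyl⟩ := exists_adj_not_isLeaf hG.connected (card_vertices_of_isTree hG) hs
      (Sum.inr e.row)
    rcases y with i | j
    swap
    · exact absurd hy not_rowColumnGraph_adj_inr_inr
    have h6 := sum_rowBranch_mul_lt hG (K := 11 / 10) (by norm_num) leafFactor_le (e₀ := e)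
      (e₁ := ⟨(i, e.row), rowColumnGraph_adj_inr_inl.1 hy⟩) rfl
      (leafFactor_lt hyl hrow)
    rw [hsum, mul_left_comm]
    refine mul_lt_mul_of_pos_left (h6.trans_le ?_) (by positivity)
    rw [hfe]
    exact mul_le_mul_of_nonneg_left (by linarith) hm
  have h1 := sum_colBranch_mul_le hG (K := 11 / 10) (by norm_num) leafFactor_le e
  have h2 := sum_rowBranch_mul_le hG (K := 11 / 10) (by norm_num) leafFactor_le e
  have hfe : leafFactor e = 1 := leafFactor_eq_one hcol hrow
  have h5 := colBranch_add_rowBranch hG e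
  have h6 : (2 : ℝ) ≤ colBranch e :=
    Nat.ofNat_le_cast.2 (two_le_branchCard_of_not_isLeaf hG e.adj hrow)
  have h7 : (2 : ℝ) ≤ rowBranch e :=
    Nat.ofNat_le_cast.2 (two_le_branchCard_of_not_isLeaf hG e.adj.symm hcol)
  refine (mul_le_mul h1 h2 (Finset.sum_nonneg fun e' _ => mul_nonneg (Nat.cast_nonneg _)
    (zero_le_one.trans (one_le_leafFactor e'))) (by positivity)).trans_lt ?_
  rw [hfe, mul_one, mul_one, mul_assoc]
  refine mul_lt_mul_of_pos_left ?_ (by linarith)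
  -- Both branches have size at least 2, so `m ≥ 3` and `x * y ≥ 2 * (m - 1)`, which exceeds `(11 /
  -- 10) ^ 2 * m`.
  nlinarith

/-- There are finitely many cells, so the strict inequalities become uniform: `c` is the largest
ratio of the two sides. -/
lemma exists_lt_gridSize_of_not_isStar [Nonempty (Cell M)] (hG : (rowColumnGraph M).IsTree)
    (hs : ¬ IsStar (rowColumnGraph M) (gridSize M)) :
    ∃ c : ℝ, 0 ≤ c ∧ c < gridSize M ∧ ∀ k,
      (maxRearrangements (Cell.col (M := M)) (Cell.row (M := M)) k : ℝ) ≤ c ^ k := by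
  have hx : ∀ e : Cell M, 0 < (colBranch e : ℝ) * leafFactor e := fun e =>
    mul_pos (one_pos.trans_le (one_le_colBranch e)) (one_pos.trans_le (one_le_leafFactor e))
  have hy : ∀ e : Cell M, 0 < (rowBranch e : ℝ) * leafFactor e := fun e =>
    mul_pos (one_pos.trans_le (one_le_rowBranch e)) (one_pos.trans_le (one_le_leafFactor e))
  obtain ⟨e₀, h₀⟩ := Finite.exists_max fun e : Cell M =>
    (∑ e' : Cell M with Cell.col e' = e.col, (colBranch e' : ℝ) * leafFactor e') *
        (∑ e' : Cell M with Cell.row e' = e.row, (rowBranch e' : ℝ) * leafFactor e') /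
      ((colBranch e * leafFactor e) * (rowBranch e * leafFactor e))
  refine ⟨_, ?_, ?_, fun k => maxRearrangements_le_pow _ _ _ _ hx hy _
    (fun e => (div_le_iff₀ (mul_pos (hx e) (hy e))).1 (h₀ e)) k⟩
  · exact div_nonneg (mul_nonneg (Finset.sum_nonneg fun e _ => (hx e).le)
      (Finset.sum_nonneg fun e _ => (hy e).le)) (mul_pos (hx _) (hy _)).le
  · rw [div_lt_iff₀ (mul_pos (hx _) (hy _))]
    exact sum_mul_sum_lt_of_not_isStar hG hs e₀

/-- If all cells share a column (or row), that monotonicity condition is vacuous: an arbitrary word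
is completed to a pair by sorting it in the other direction. -/
lemma pow_le_ncard_wordPairs_of_forall_adj {v : Fin t ⊕ Fin u}
    (hv : ∀ a b, (rowColumnGraph M).Adj a b → a = v ∨ b = v) (k : ℕ) :
    gridSize M ^ k ≤ (wordPairs (Cell.col (M := M)) (Cell.row (M := M)) k).ncard := by
  have hc : gridSize M ^ k = (Set.univ : Set (Fin k → Cell M)).ncard := by
    rw [Set.ncard_univ, Nat.card_fun, gridSize_eq_card, Nat.card_eq_fintype_card (α := Fin k),
      Fintype.card_fin]
  rw [hc]
  rcases v with i | j
  · have hcol : ∀ e : Cell M, e.col = i := fun e => by simpa using hv _ _ e.adj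
    refine Set.ncard_le_ncard_of_injOn (fun f => (f, f ∘ Tuple.sort (Cell.row ∘ f))) ?_ ?_
      (Set.toFinite _)
    · intro f _
      refine ⟨fun p q _ => ?_, Tuple.monotone_sort (Cell.row ∘ f),
        (Tuple.sort (Cell.row ∘ f))⁻¹, ?_⟩
      · simp [hcol]
      · funext p
        simp
    · intro f _ f' _ h
      exact congrArg Prod.fst h
  · have hrow : ∀ e : Cell M, e.row = j := fun e => by simpa using hv _ _ e.adj
    refine Set.ncard_le_ncard_of_injOn (fun f => (f ∘ Tuple.sort (Cell.col ∘ f), f)) ?_ ?_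
      (Set.toFinite _)
    · intro f _
      refine ⟨Tuple.monotone_sort (Cell.col ∘ f), fun p q _ => ?_,
        Tuple.sort (Cell.col ∘ f), rfl⟩
      simp [hrow]
    · intro f _ f' _ h
      exact congrArg Prod.snd h

lemma hasGrowthRate_zero_of_isEmpty [IsEmpty (Cell M)] : HasGrowthRate (gridClass M) 0 := by
  refine tendsto_const_nhds.congr' ?_
  filter_upwards [eventually_ne_atTop 0] with k hk
  have : Nonempty (Fin k) := ⟨⟨0, Nat.pos_of_ne_zero hk⟩⟩
  have h := ncard_gridClass_le_ncard_wordPairs M k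
  rw [Set.eq_empty_of_isEmpty (wordPairs _ _ _), Set.ncard_empty, Nat.le_zero] at h
  rw [h, Nat.cast_zero, Real.zero_rpow]
  exact one_div_ne_zero (Nat.cast_ne_zero.2 hk)

lemma exists_growthRate (hG : (rowColumnGraph M).IsTree) :
    ∃ g : ℝ, HasGrowthRate (gridClass M) g ∧ g ≤ gridSize M ∧
      (g = gridSize M ↔ IsStar (rowColumnGraph M) (gridSize M)) := by
  rcases isEmpty_or_nonempty (Cell M) with hE | hE
  · have h0 : gridSize M = 0 := by
      rw [gridSize_eq_card]
      simp
    refine ⟨0, hasGrowthRate_zero_of_isEmpty, Nat.cast_nonneg _, ?_⟩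
    obtain ⟨v⟩ := hG.connected.nonempty
    have hcard := card_vertices_of_isTree hG
    -- Size 0 forces a single vertex, which is the star with no edges.
    refine iff_of_true (by simp [h0]) (isStar_of_forall_adj hG.connected hcard v fun a b _ => ?_)
    rw [h0, zero_add, Nat.card_eq_one_iff_unique] at hcard
    have := hcard.1
    exact Or.inl (Subsingleton.elim _ _)
  · obtain ⟨L, hL⟩ := exists_tendsto_maxRearrangements (Cell.col (M := M)) (Cell.row (M := M))
    have hle := le_of_tendsto_of_le_pow (Nat.cast_nonneg _)
      (maxRearrangements_le_gridSize_pow hG) hL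
    refine ⟨L, hasGrowthRate_gridClass hL, hle, fun h => ?_, fun h => le_antisymm hle ?_⟩
    · by_contra hs
      obtain ⟨c, hc0, hc, hk⟩ := exists_lt_gridSize_of_not_isStar hG hs
      exact absurd (le_of_tendsto_of_le_pow hc0 hk hL) (not_le.2 (h ▸ hc))
    · obtain ⟨v, hv⟩ := h.exists_forall_adj
      refine le_of_tendsto_of_pow_le (Nat.cast_nonneg _) (fun k => ?_)
        -- The pairs of words also grow at rate `L`, so their lower bound `m ^ k` passes to `L`; `A
        -- = 0` since they dominate `maxRearrangements` without any factor.
        (tendsto_rpow_of_polynomial_bounds (A := 0) (fun k => ?_) (ncard_wordPairs_le _ _) hL)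
      · exact_mod_cast pow_le_ncard_wordPairs_of_forall_adj hv k
      · simpa using maxRearrangements_le_ncard_wordPairs _ _ k

lemma gridSize_of_skinny {M : Matrix (Fin m) (Fin 1) SignType} (hM : ∀ i j, M i j ≠ 0) :
    gridSize M = m := by
  simp [gridSize, hM]

lemma connected_of_skinny {M : Matrix (Fin m) (Fin 1) SignType} (hM : ∀ i j, M i j ≠ 0) :
    (rowColumnGraph M).Connected := by
  have h : ∀ x, (rowColumnGraph M).Reachable x (Sum.inr 0) := by
    rintro (i | j)
    · exact (rowColumnGraph_adj_inl_inr.2 (hM i 0)).reachable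
    · rw [Subsingleton.elim j 0]
  exact { preconnected := fun x y => (h x).trans (h y).symm, nonempty := ⟨Sum.inr 0⟩ }

lemma isTree_of_skinny {M : Matrix (Fin m) (Fin 1) SignType} (hM : ∀ i j, M i j ≠ 0) :
    (rowColumnGraph M).IsTree := by
  rw [SimpleGraph.isTree_iff_connected_and_card, card_edgeSet_rowColumnGraph, gridSize_of_skinny hM]
  exact ⟨connected_of_skinny hM, by simp⟩

lemma isStar_of_skinny {M : Matrix (Fin m) (Fin 1) SignType} (hM : ∀ i j, M i j ≠ 0) :
    IsStar (rowColumnGraph M) m := by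
  refine isStar_of_forall_adj (connected_of_skinny hM) (by simp) (Sum.inr 0) ?_
  rintro (i | j) (i' | j') h
  · exact absurd h not_rowColumnGraph_adj_inl_inl
  · exact Or.inr (congrArg _ (Subsingleton.elim _ _))
  · exact Or.inl (congrArg _ (Subsingleton.elim _ _))
  · exact absurd h not_rowColumnGraph_adj_inr_inr

end RowColumnGraph

end MonotoneGrid

theorem mainTheorem12 (m : ℕ) :
    (∀ (t u : ℕ) (M : Matrix (Fin t) (Fin u) SignType),
      (MonotoneGrid.rowColumnGraph M).Connected →
      (MonotoneGrid.rowColumnGraph M).IsAcyclic →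
      MonotoneGrid.gridSize M = m →
      ∃ g : ℝ, MonotoneGrid.HasGrowthRate (MonotoneGrid.gridClass M) g ∧ g ≤ (m : ℝ) ∧
        (g = (m : ℝ) ↔ MonotoneGrid.IsStar (MonotoneGrid.rowColumnGraph M) m)) ∧
    (∀ M : Matrix (Fin m) (Fin 1) SignType, (∀ i j, M i j ≠ 0) →
      (MonotoneGrid.rowColumnGraph M).Connected ∧
      (MonotoneGrid.rowColumnGraph M).IsAcyclic ∧
      MonotoneGrid.gridSize M = m ∧
      MonotoneGrid.IsStar (MonotoneGrid.rowColumnGraph M) m ∧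
      MonotoneGrid.HasGrowthRate (MonotoneGrid.gridClass M) (m : ℝ)) := by
  refine ⟨?_, fun M hM => ?_⟩
  · rintro t u M hconn hacyc rfl
    exact MonotoneGrid.exists_growthRate ⟨hconn, hacyc⟩
  · have hT := MonotoneGrid.isTree_of_skinny hM
    have hS := MonotoneGrid.isStar_of_skinny hM
    have hm := MonotoneGrid.gridSize_of_skinny hM
    obtain ⟨g, hg, -, hiff⟩ := MonotoneGrid.exists_growthRate hT
    rw [hm] at hiff
    exact ⟨hT.connected, hT.isAcyclic, hm, hS, hiff.2 hS ▸ hg⟩
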